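/- Let $m,n\ge 1$. For a matrix polynomial $P(z)=\sum_{j=0}^m z^jA_j$ with $A_j\in\mathbb C^{n\times n}$ and $M\in\{F,2\}$ (Frobenius or spectral norm) put $|||P|||_M=\big(\sum_{j=0}^m\|A_j\|_M^2\big)^{1/2}$. For a set $S$ of matrix polynomials of the same size and degree bound as $P$, for $\lambda\in\mathbb C$ and a vector $x\neq 0$, let $$\eta_M^{S}(\lambda,x,P)=\min\{\,|||\Delta P|||_M : \Delta P\in S,\ P(\lambda)x+\Delta P(\lambda)x=0\,\},$$ and write $\eta_M(\lambda,x,P)$ when $S$ is the set of all such polynomials. Let $P^H(z)=\sum_{j=0}^m z^jA_j^H$; $P$ is $H$-palindromic if $P^H(z)=z^mP(1/z)$ for all $z\ne0$, and $H$-anti-palindromic if $P^H(z)=-z^mP(1/z)$ for all $z\neq 0$. Write $\Lambda_{m-1}(z)=[z^{m-1},\dots,z,1]^T$, $\Lambda_{m-1}=\Lambda_{m-1}(\lambda)$, and let $R$ be the $m\times m$ flip matrix (ones on the antidiagonal, zeros elsewhere). Theorem 4.5. Let $P$ be $H$-palindromic of degree at most $m$, and let $\mathbb S_p$ be the set of $n\times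 n$ $H$-palindromic matrix polynomials of degree at most $m$ (palindromic with respect to $m$). Let $v\in\mathbb C^m$ with $\|v\|_2=1$ and let $L(z)=zX+Y$ with $X,Y\in\mathbb C^{mn\times mn}$ belong to $\mathbb L_1(P)$ with right ansatz vector $v$, that is, $$L(z)(\Lambda_{m-1}(z)\otimes I_n)=v\otimes P(z)\quad\text{for all } z\in\mathbb C.$$ Suppose that either $L$ is $H$-palindromic and $Rv=\overline v$, in which case $\mathbb S$ denotes the set of all $mn\times mn$ $H$-palindromic pencils, or $L$ is $H$-anti-palindromic and $Rv=-\overline v$, in which case $\mathbb S$ denotes the set of all $mn\times mn$ $H$-anti-palindromic pencils. (Every $H$-palindromic or $H$-anti-palindromic linearization of $P$ in $\mathbb L_1(P)$ with such an ansatz vector is included.) Let $|\lambda|=1$ and $x\in\mathbb C^n$ with $\|x\|_2=1$. Then the minima defining the backward errors below are attained, and $$\sqrt{\tfrac{m+1}{2m}}\;\eta_F(\lambda,x,P)\ \le\ \eta_F^{\mathbb S}(\lambda,\Lambda_{m-1}\otimes x,L)\ \le\ \sqrt2\,\eta_F(\lambda,x,P),\qquad \eta_F^{\mathbb S}(\lambda,\Lambda_{m-1}\otimes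 x,L)\ \le\ \sqrt2\,\eta_F^{\mathbb S_p}(\lambda,x,P),$$ $$\sqrt{\tfrac{m+1}{2m}}\;\eta_2(\lambda,x,P)\ \le\ \eta_2^{\mathbb S}(\lambda,\Lambda_{m-1}\otimes x,L)\ \le\ \sqrt2\,\eta_2(\lambda,x,P),\qquad \eta_2(\lambda,x,P)=\eta_2^{\mathbb S_p}(\lambda,x,P).$$ -/

import Mathlib

open scoped Matrix

/-- Matrix polynomials `P(z) = ∑_{j=0}^m z^j A_j` of (formal) degree `m` with square complex
coefficients, given by the coefficient family `A_0, …, A_m`. A pencil `z X + Y` is the case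
`m = 1`, with `A_0 = Y` and `A_1 = X`. -/
abbrev MatPoly (m : ℕ) (ι : Type) : Type := Fin (m + 1) → Matrix ι ι ℂ

/-- The value `P(z) = ∑_{j=0}^m z^j A_j`. -/
def MatPoly.value {m : ℕ} {ι : Type} (P : MatPoly m ι) (z : ℂ) : Matrix ι ι ℂ :=
  ∑ j : Fin (m + 1), z ^ (j : ℕ) • P j

/-- `P^H(z) = ∑_{j=0}^m z^j A_j^H`: the coefficients are replaced by their conjugate transposes. -/
def MatPoly.conj {m : ℕ} {ι : Type} (P : MatPoly m ι) : MatPoly m ι := fun j => (P j)ᴴ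

/-- The `H`-palindromic matrix polynomials: `P^H(z) = z^m P(1/z)` for all `z ≠ 0`. -/
def hPalindromic (m : ℕ) (ι : Type) : Set (MatPoly m ι) :=
  {P | ∀ z : ℂ, z ≠ 0 → P.conj.value z = z ^ m • P.value (1 / z)}

/-- The `H`-anti-palindromic matrix polynomials: `P^H(z) = - z^m P(1/z)` for all `z ≠ 0`. -/
def hAntiPalindromic (m : ℕ) (ι : Type) : Set (MatPoly m ι) :=
  {P | ∀ z : ℂ, z ≠ 0 → P.conj.value z = -(z ^ m • P.value (1 / z))}

/-- The matrix norms in use: Frobenius (`F`) and spectral (`two`). -/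
inductive NormKind : Type
  | F : NormKind
  | two : NormKind

open scoped Matrix.Norms.Frobenius in
/-- The Frobenius norm of a complex square matrix. -/
noncomputable def frobNorm {ι : Type} [Fintype ι] (A : Matrix ι ι ℂ) : ℝ := ‖A‖

open scoped Matrix.Norms.L2Operator in
/-- The spectral norm of a complex square matrix: the operator norm for the Euclidean norm. -/
noncomputable def specNorm {ι : Type} [Fintype ι] [DecidableEq ι] (A : Matrix ι ι ℂ) : ℝ := ‖A‖

/-- The matrix norm `‖·‖_M`, `M ∈ {F, 2}`. -/
noncomputable def matNorm {ι : Type} [Fintype ι] [DecidableEq ι] :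
    NormKind → Matrix ι ι ℂ → ℝ
  | NormKind.F, A => frobNorm A
  | NormKind.two, A => specNorm A

/-- The norm `|||P|||_M = (∑_j ‖A_j‖_M ^ 2)^(1/2)` of a matrix polynomial. -/
noncomputable def MatPoly.norm {m : ℕ} {ι : Type} [Fintype ι] [DecidableEq ι]
    (M : NormKind) (P : MatPoly m ι) : ℝ :=
  Real.sqrt (∑ j : Fin (m + 1), matNorm M (P j) ^ 2)

/-- The norms `|||ΔP|||_M` of the perturbations `ΔP` in `S` with `P(μ) x + ΔP(μ) x = 0`. -/
def perturbationNorms {m : ℕ} {ι : Type} [Fintype ι] [DecidableEq ι]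
    (M : NormKind) (S : Set (MatPoly m ι)) (μ : ℂ) (x : ι → ℂ) (P : MatPoly m ι) : Set ℝ :=
  {e | ∃ D ∈ S, P.value μ *ᵥ x + D.value μ *ᵥ x = 0 ∧ D.norm M = e}

/-- The structured backward error `η_M^S(μ, x, P)`. -/
noncomputable def structuredBackwardError {m : ℕ} {ι : Type} [Fintype ι] [DecidableEq ι]
    (M : NormKind) (S : Set (MatPoly m ι)) (μ : ℂ) (x : ι → ℂ) (P : MatPoly m ι) : ℝ :=
  sInf (perturbationNorms M S μ x P)

/-- The (unstructured) backward error `η_M(μ, x, P)`: all perturbations are allowed. -/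
noncomputable def backwardError {m : ℕ} {ι : Type} [Fintype ι] [DecidableEq ι]
    (M : NormKind) (μ : ℂ) (x : ι → ℂ) (P : MatPoly m ι) : ℝ :=
  structuredBackwardError M Set.univ μ x P

/-- The vector `Λ_{m-1} = (z^(m-1), …, z, 1)` of length `m`. -/
def lambdaVec (m : ℕ) (z : ℂ) : Fin m → ℂ := fun i => z ^ (m - 1 - (i : ℕ))

/-- The Kronecker product `u ⊗ x` of two column vectors. -/
def kronVec {m n : ℕ} (u : Fin m → ℂ) (x : Fin n → ℂ) : Fin m × Fin n → ℂ :=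
  fun p => u p.1 * x p.2

/-- The Kronecker product `u ⊗ B` of a column vector and a matrix. -/
def kronMat {m n : ℕ} (u : Fin m → ℂ) (B : Matrix (Fin n) (Fin n) ℂ) :
    Matrix (Fin m × Fin n) (Fin n) ℂ :=
  Matrix.of fun p b => u p.1 * B p.2 b

/-- The pencils `L(z) = z X + Y` in `𝕃₁(P)` with right ansatz vector `v`:
`L(z) (Λ_{m-1}(z) ⊗ I) = v ⊗ P(z)`, identically in `z`. -/
def ansatzPencils {m n : ℕ} (P : MatPoly m (Fin n)) (v : Fin m → ℂ) :
    Set (MatPoly 1 (Fin m × Fin n)) :=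
  {L | ∀ z : ℂ,
    L.value z * kronMat (lambdaVec m z) (1 : Matrix (Fin n) (Fin n) ℂ) = kronMat v (P.value z)}

/-! On the unit circle every backward error here is controlled by a residual norm. Let `r =
‖P(μ)x‖`. By Cauchy–Schwarz over the `m + 1` coefficients (`MatPoly.norm_value_mulVec_le`), any
perturbation cancelling the residual has norm at least `r / √(m+1)`; a rank-one matrix spread evenly
over the coefficients attains this (`backwardError_le`), in both norms.

For palindromic `P`, choose `s` with `s² = μ`: then `s⁻ᵐ P(μ)` is Hermitian, and a Hermitian `K`
agreeing with it on the vector spreads over the coefficients as a palindromic perturbation of norm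
`‖K‖ / √(m+1)`. A Householder reflection makes the spectral norm of `K` minimal, whence the equality
of the two spectral errors of `P`; in Frobenius norm the cost is at most a factor `√2`.
Multiplication by `i` carries this to the anti-palindromic case.

The pencil has degree one, its vector `Λ ⊗ x` has norm `√m`, and the ansatz identity with `‖v‖ = 1`
makes its residual norm again `r`. Hence its structured error lies between `r / √(2m)` and `r / √m`;
comparing with `r / √(m+1)`, and using `m + 1 ≤ 2m`, gives the constants. -/

section Norms

/-! ### Frobenius and spectral norms. -/

variable {ι : Type} [Fintype ι]

theorem star_dotProduct_self_eq_norm_sq (u : ι → ℂ) :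
    star u ⬝ᵥ u = ((‖WithLp.toLp 2 u‖ ^ 2 : ℝ) : ℂ) := by
  rw [EuclideanSpace.norm_sq_eq]
  simp [dotProduct, Complex.conj_mul']

theorem norm_toLp_smul (c : ℂ) (u : ι → ℂ) :
    ‖WithLp.toLp 2 (c • u)‖ = ‖c‖ * ‖WithLp.toLp 2 u‖ := by
  rw [WithLp.toLp_smul, norm_smul]

theorem frobNorm_eq_sqrt (A : Matrix ι ι ℂ) :
    frobNorm A = Real.sqrt (∑ i, ∑ j, ‖A i j‖ ^ 2) := by
  rw [frobNorm, Matrix.frobenius_norm_def, Real.sqrt_eq_rpow]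
  simp

theorem frobNorm_sq (A : Matrix ι ι ℂ) : frobNorm A ^ 2 = ∑ i, ∑ j, ‖A i j‖ ^ 2 := by
  rw [frobNorm_eq_sqrt, Real.sq_sqrt (by positivity)]

theorem frobNorm_nonneg (A : Matrix ι ι ℂ) : 0 ≤ frobNorm A := by
  rw [frobNorm_eq_sqrt]; positivity

theorem frobNorm_sq_eq_trace (A : Matrix ι ι ℂ) :
    ((frobNorm A ^ 2 : ℝ) : ℂ) = (Aᴴ * A).trace := by
  rw [frobNorm_sq, Finset.sum_comm]
  simp [Matrix.trace, Matrix.mul_apply, Complex.conj_mul']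

open scoped Matrix.Norms.Frobenius in
theorem frobNorm_smul (c : ℂ) (A : Matrix ι ι ℂ) : frobNorm (c • A) = ‖c‖ * frobNorm A :=
  norm_smul c A

theorem frobNorm_vecMulVec (u w : ι → ℂ) :
    frobNorm (Matrix.vecMulVec u (star w)) = ‖WithLp.toLp 2 u‖ * ‖WithLp.toLp 2 w‖ := by
  rw [← sq_eq_sq₀ (frobNorm_nonneg _) (by positivity), frobNorm_sq, mul_pow,
    EuclideanSpace.norm_sq_eq, EuclideanSpace.norm_sq_eq, Finset.sum_mul_sum]
  simp [Matrix.vecMulVec_apply, mul_pow]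

open scoped Matrix.Norms.Frobenius in
theorem norm_mulVec_le_frobNorm (A : Matrix ι ι ℂ) (u : ι → ℂ) :
    ‖WithLp.toLp 2 (A *ᵥ u)‖ ≤ frobNorm A * ‖WithLp.toLp 2 u‖ := by
  have h := Matrix.frobenius_norm_mul A (Matrix.replicateCol Unit u)
  rwa [← Matrix.replicateCol_mulVec, Matrix.frobenius_norm_replicateCol,
    Matrix.frobenius_norm_replicateCol] at h

variable [DecidableEq ι]

theorem specNorm_eq (A : Matrix ι ι ℂ) :
    specNorm A = ‖Matrix.toEuclideanCLM (n := ι) (𝕜 := ℂ) A‖ := rfl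

theorem specNorm_nonneg (A : Matrix ι ι ℂ) : 0 ≤ specNorm A := by
  rw [specNorm_eq]; positivity

theorem norm_mulVec_le_specNorm (A : Matrix ι ι ℂ) (u : ι → ℂ) :
    ‖WithLp.toLp 2 (A *ᵥ u)‖ ≤ specNorm A * ‖WithLp.toLp 2 u‖ := by
  rw [specNorm_eq, ← Matrix.toEuclideanCLM_toLp]
  exact ContinuousLinearMap.le_opNorm _ _

theorem specNorm_le_of_forall {A : Matrix ι ι ℂ} {c : ℝ} (hc : 0 ≤ c)
    (h : ∀ u : ι → ℂ, ‖WithLp.toLp 2 (A *ᵥ u)‖ ≤ c * ‖WithLp.toLp 2 u‖) : specNorm A ≤ c := by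
  rw [specNorm_eq]
  refine ContinuousLinearMap.opNorm_le_bound _ hc fun u => ?_
  exact h u.ofLp

theorem specNorm_le_frobNorm (A : Matrix ι ι ℂ) : specNorm A ≤ frobNorm A :=
  specNorm_le_of_forall (frobNorm_nonneg A) (norm_mulVec_le_frobNorm A)

theorem specNorm_smul (c : ℂ) (A : Matrix ι ι ℂ) : specNorm (c • A) = ‖c‖ * specNorm A := by
  rw [specNorm_eq, map_smul, norm_smul, specNorm_eq]

open scoped Matrix.Norms.L2Operator in
theorem specNorm_conjTranspose_mul_self (A : Matrix ι ι ℂ) :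
    specNorm (Aᴴ * A) = specNorm A * specNorm A :=
  Matrix.l2_opNorm_conjTranspose_mul_self A

/-- Such a matrix is `c` times a unitary; the C*-identity turns the bound on `Aᴴ * A` into one on
`A`. -/
theorem specNorm_le_of_conjTranspose_mul_self {A : Matrix ι ι ℂ} {c : ℝ} (hc : 0 ≤ c)
    (h : Aᴴ * A = ((c ^ 2 : ℝ) : ℂ) • (1 : Matrix ι ι ℂ)) : specNorm A ≤ c := by
  have h1 : specNorm (Aᴴ * A) ≤ c ^ 2 := by
    refine specNorm_le_of_forall (sq_nonneg c) fun u => ?_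
    rw [h, Matrix.smul_mulVec, Matrix.one_mulVec, norm_toLp_smul, Complex.norm_real,
      Real.norm_of_nonneg (sq_nonneg c)]
  rw [specNorm_conjTranspose_mul_self, ← sq] at h1
  exact (sq_le_sq₀ (specNorm_nonneg A) hc).1 h1

theorem matNorm_nonneg (M : NormKind) (A : Matrix ι ι ℂ) : 0 ≤ matNorm M A := by
  cases M
  exacts [frobNorm_nonneg A, specNorm_nonneg A]

theorem matNorm_smul (M : NormKind) (c : ℂ) (A : Matrix ι ι ℂ) :
    matNorm M (c • A) = ‖c‖ * matNorm M A := by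
  cases M
  exacts [frobNorm_smul c A, specNorm_smul c A]

theorem norm_mulVec_le_matNorm (M : NormKind) (A : Matrix ι ι ℂ) (u : ι → ℂ) :
    ‖WithLp.toLp 2 (A *ᵥ u)‖ ≤ matNorm M A * ‖WithLp.toLp 2 u‖ := by
  cases M
  exacts [norm_mulVec_le_frobNorm A u, norm_mulVec_le_specNorm A u]

theorem matNorm_le_frobNorm (M : NormKind) (A : Matrix ι ι ℂ) : matNorm M A ≤ frobNorm A := by
  cases M
  exacts [le_rfl, specNorm_le_frobNorm A]

theorem norm_entry_le_matNorm (M : NormKind) (A : Matrix ι ι ℂ) (i j : ι) :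
    ‖A i j‖ ≤ matNorm M A := by
  have h := norm_mulVec_le_matNorm M A (Pi.single j 1)
  have h1 : ‖WithLp.toLp 2 (Pi.single j 1 : ι → ℂ)‖ = 1 := by simp
  have h2 := PiLp.norm_apply_le (WithLp.toLp 2 (A *ᵥ Pi.single j 1)) i
  rw [h1, mul_one] at h
  refine le_trans ?_ (h2.trans h)
  simp

theorem continuous_matNorm (M : NormKind) :
    Continuous (matNorm M : Matrix ι ι ℂ → ℝ) := by
  cases M
  · have : (matNorm NormKind.F : Matrix ι ι ℂ → ℝ) =
        fun A => Real.sqrt (∑ i, ∑ j, ‖A i j‖ ^ 2) := funext frobNorm_eq_sqrt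
    rw [this]
    fun_prop
  · exact continuous_norm.comp
      (LinearMap.continuous_of_finiteDimensional
        (Matrix.toEuclideanCLM (n := ι) (𝕜 := ℂ)).toAlgEquiv.toLinearMap)

end Norms

/-! ### Hermitian matrices with a prescribed image of one vector. -/

section Hermitian

variable {ι : Type} [Fintype ι]

/-- For a Hermitian `G` and a unit vector `u`, the Hermitian matrix `Gp + pG - pGp`, where `p`
projects onto the line of `u`, agrees with `G` on `u`. -/
theorem exists_isHermitian_frobNorm_le_of_unit {G : Matrix ι ι ℂ} (hG : G.IsHermitian)
    {u : ι → ℂ} (hu : ‖WithLp.toLp 2 u‖ = 1) :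
    ∃ K : Matrix ι ι ℂ, K.IsHermitian ∧ K *ᵥ u = G *ᵥ u ∧
      frobNorm K ≤ Real.sqrt 2 * ‖WithLp.toLp 2 (G *ᵥ u)‖ := by
  have huu : star u ⬝ᵥ u = 1 := by rw [star_dotProduct_self_eq_norm_sq, hu]; simp
  obtain ⟨b, hb⟩ : ∃ b, b = G *ᵥ u := ⟨_, rfl⟩
  obtain ⟨a, ha⟩ : ∃ a, a = star u ⬝ᵥ b := ⟨_, rfl⟩
  have hbu : star b ⬝ᵥ u = a := by
    rw [ha, hb, Matrix.star_mulVec, hG.eq, Matrix.dotProduct_mulVec]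
  have haa : star a = a := by
    nth_rewrite 2 [← hbu]
    rw [ha, Matrix.star_dotProduct, dotProduct_comm]
    simp
  obtain ⟨K, hK⟩ : ∃ K, K = Matrix.vecMulVec b (star u) + Matrix.vecMulVec u (star b) -
    a • Matrix.vecMulVec u (star u) := ⟨_, rfl⟩
  have hKh : K.IsHermitian := by
    rw [Matrix.IsHermitian, hK]
    simp only [Matrix.conjTranspose_sub, Matrix.conjTranspose_add, Matrix.conjTranspose_smul,
      Matrix.conjTranspose_vecMulVec, star_star, haa]
    abel
  have hKu : K *ᵥ u = b := by
    rw [hK]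
    ext i
    simp [Matrix.sub_mulVec, Matrix.add_mulVec, Matrix.smul_mulVec, Matrix.vecMulVec_mulVec,
      huu, hbu]
  refine ⟨K, hKh, by rw [hKu, hb], ?_⟩
  rw [← hb]
  -- This is `‖K‖_F² = 2‖b‖² - |a|²`; dropping `|a|²` leaves the factor `√2`.
  have htr : (Kᴴ * K).trace = star b ⬝ᵥ b + star b ⬝ᵥ b - a * a := by
    have h1 : Kᴴ * K = K * (Matrix.vecMulVec b (star u) + Matrix.vecMulVec u (star b) -
        a • Matrix.vecMulVec u (star u)) := by rw [hKh.eq, ← hK]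
    have h2 : star u ⬝ᵥ K *ᵥ b = star b ⬝ᵥ b := by
      rw [Matrix.dotProduct_mulVec, ← hKu, Matrix.star_mulVec, hKh.eq]
    rw [h1, mul_sub, mul_add, mul_smul_comm, Matrix.mul_vecMulVec, Matrix.mul_vecMulVec,
      Matrix.mul_vecMulVec, hKu, Matrix.trace_sub, Matrix.trace_add, Matrix.trace_smul,
      Matrix.trace_vecMulVec, Matrix.trace_vecMulVec, Matrix.trace_vecMulVec,
      dotProduct_comm _ (star u), dotProduct_comm _ (star b), dotProduct_comm _ (star u), h2,
      ← ha, smul_eq_mul]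
  have har : a * a = ((‖a‖ ^ 2 : ℝ) : ℂ) := by
    nth_rewrite 1 [← haa]
    simpa using Complex.conj_mul' a
  rw [← frobNorm_sq_eq_trace, star_dotProduct_self_eq_norm_sq, har] at htr
  norm_cast at htr
  rw [← sq_le_sq₀ (frobNorm_nonneg _) (by positivity), mul_pow, Real.sq_sqrt (by norm_num), htr]
  nlinarith [sq_nonneg ‖a‖]

theorem exists_isHermitian_frobNorm_le {G : Matrix ι ι ℂ} (hG : G.IsHermitian)
    {u : ι → ℂ} (hu : ‖WithLp.toLp 2 u‖ ≠ 0) :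
    ∃ K : Matrix ι ι ℂ, K.IsHermitian ∧ K *ᵥ u = G *ᵥ u ∧
      frobNorm K ≤ Real.sqrt 2 * (‖WithLp.toLp 2 (G *ᵥ u)‖ / ‖WithLp.toLp 2 u‖) := by
  obtain ⟨c, hc⟩ : ∃ c, c = ‖WithLp.toLp 2 u‖ := ⟨_, rfl⟩
  rw [← hc] at hu ⊢
  have hc0 : 0 ≤ c := hc ▸ norm_nonneg _
  have hcc : ‖((c⁻¹ : ℝ) : ℂ)‖ = c⁻¹ := by
    rw [Complex.norm_real, Real.norm_of_nonneg (inv_nonneg.2 hc0)]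
  have hunit : ‖WithLp.toLp 2 (((c⁻¹ : ℝ) : ℂ) • u)‖ = 1 := by
    rw [norm_toLp_smul, hcc, ← hc, inv_mul_cancel₀ hu]
  obtain ⟨K, hK, hKu, hn⟩ := exists_isHermitian_frobNorm_le_of_unit hG hunit
  rw [Matrix.mulVec_smul, Matrix.mulVec_smul] at hKu
  refine ⟨K, hK, ?_, ?_⟩
  · exact (smul_right_injective (ι → ℂ)
      (Complex.ofReal_ne_zero.2 (inv_ne_zero hu))) hKu
  · rwa [Matrix.mulVec_smul, norm_toLp_smul, hcc, mul_comm c⁻¹, ← div_eq_mul_inv] at hn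

variable [DecidableEq ι]

/-- For a Hermitian `G` and a unit vector `u`, a multiple of a Householder reflection agrees with
`G` on `u`. -/
theorem exists_isHermitian_specNorm_le {G : Matrix ι ι ℂ} (hG : G.IsHermitian)
    {u : ι → ℂ} (hu : ‖WithLp.toLp 2 u‖ = 1) :
    ∃ K : Matrix ι ι ℂ, K.IsHermitian ∧ K *ᵥ u = G *ᵥ u ∧
      specNorm K ≤ ‖WithLp.toLp 2 (G *ᵥ u)‖ := by
  have huu : star u ⬝ᵥ u = 1 := by rw [star_dotProduct_self_eq_norm_sq, hu]; simp
  obtain ⟨b, hb⟩ : ∃ b, b = G *ᵥ u := ⟨_, rfl⟩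
  obtain ⟨a, ha⟩ : ∃ a, a = star u ⬝ᵥ b := ⟨_, rfl⟩
  have hbu : star b ⬝ᵥ u = a := by
    rw [ha, hb, Matrix.star_mulVec, hG.eq, Matrix.dotProduct_mulVec]
  rw [← hb]
  obtain ⟨β, hβ⟩ : ∃ β : ℝ, β = ‖WithLp.toLp 2 b‖ := ⟨_, rfl⟩
  have hbb : star b ⬝ᵥ b = (β : ℂ) ^ 2 := by
    rw [star_dotProduct_self_eq_norm_sq, ← hβ]; norm_cast
  have hβ0 : 0 ≤ β := hβ ▸ norm_nonneg _
  -- The reflection along `w` exchanges `β u` and `b`: they have equal length, and their inner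
  -- product is real because `G` is Hermitian.
  obtain ⟨w, hw⟩ : ∃ w, w = (β : ℂ) • u - b := ⟨_, rfl⟩
  obtain ⟨d, hd⟩ : ∃ d, d = ‖WithLp.toLp 2 w‖ ^ 2 := ⟨_, rfl⟩
  have hww : star w ⬝ᵥ w = (d : ℂ) := by
    rw [star_dotProduct_self_eq_norm_sq, hd]
  have hwu : star w ⬝ᵥ u = β - a := by
    simp [hw, sub_dotProduct, huu, hbu]
  have hd2 : (d : ℂ) = 2 * β * (β - a) := by
    rw [← hww, hw]
    simp [sub_dotProduct, dotProduct_sub, huu, hbu, ← ha, hbb]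
    ring
  have hd0 : d = 0 → w = 0 := by
    intro h
    rw [hd] at h
    simpa using h
  -- If `d = 0`, then `e = 0` by the convention for division, `w = 0`, and `K = β • 1` already sends
  -- `u` to `b`.
  obtain ⟨e, he⟩ : ∃ e : ℝ, e = 2 / d := ⟨_, rfl⟩
  obtain ⟨K, hK⟩ : ∃ K, K = (β : ℂ) • ((1 : Matrix ι ι ℂ) -
    (e : ℂ) • Matrix.vecMulVec w (star w)) := ⟨_, rfl⟩
  have hKh : K.IsHermitian := by
    rw [Matrix.IsHermitian, hK]
    simp [Matrix.conjTranspose_sub, Matrix.conjTranspose_smul, Matrix.conjTranspose_vecMulVec]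
  refine ⟨K, hKh, ?_, ?_⟩
  · have h1 : K *ᵥ u = (β : ℂ) • u - ((β : ℂ) * e * (β - a)) • w := by
      rw [hK]
      ext i
      simp [Matrix.sub_mulVec, Matrix.smul_mulVec, Matrix.vecMulVec_mulVec, hwu]
      ring
    rw [h1]
    by_cases h0 : d = 0
    · rw [hd0 h0] at hw ⊢
      rw [smul_zero, sub_zero, ← sub_eq_zero, ← hw]
    · have : (β : ℂ) * e * (β - a) = 1 := by
        have h0' : (d : ℂ) ≠ 0 := Complex.ofReal_ne_zero.2 h0
        rw [he]
        push_cast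
        field_simp
        rw [hd2]
        ring
      rw [this, one_smul, hw, sub_sub_cancel]
  · refine hβ ▸ specNorm_le_of_conjTranspose_mul_self hβ0 ?_
    have hed : ((e : ℂ) * e * d) • Matrix.vecMulVec w (star w) =
        (2 * e : ℂ) • Matrix.vecMulVec w (star w) := by
      by_cases h0 : d = 0
      · simp [hd0 h0]
      · congr 1
        have h0' : (d : ℂ) ≠ 0 := Complex.ofReal_ne_zero.2 h0
        rw [he]
        push_cast
        field_simp
    have hsq : Matrix.vecMulVec w (star w) * Matrix.vecMulVec w (star w) =
        (d : ℂ) • Matrix.vecMulVec w (star w) := by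
      rw [Matrix.vecMulVec_mul_vecMulVec, hww, Matrix.vecMulVec_smul]
    rw [hKh.eq, hK, smul_mul_smul_comm, sub_mul, mul_sub, mul_sub, one_mul, mul_one, one_mul,
      smul_mul_smul_comm, hsq, smul_smul, hed]
    push_cast
    rw [sq]
    congr 1
    module

end Hermitian

/-! ### Palindromic and anti-palindromic symmetry. -/

section MatPoly

variable {m : ℕ} {ι : Type}

theorem MatPoly.conj_value (P : MatPoly m ι) (z : ℂ) :
    P.conj.value z = (P.value (star z))ᴴ := by
  simp [MatPoly.value, MatPoly.conj, Matrix.conjTranspose_sum, Matrix.conjTranspose_smul]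

theorem MatPoly.value_smul (c : ℂ) (P : MatPoly m ι) (z : ℂ) :
    MatPoly.value (c • P) z = c • P.value z := by
  simp only [MatPoly.value, Pi.smul_apply, Finset.smul_sum]
  exact Finset.sum_congr rfl fun j _ => smul_comm _ _ _

theorem MatPoly.value_neg (P : MatPoly m ι) (z : ℂ) : MatPoly.value (-P) z = -P.value z := by
  simp [MatPoly.value]

theorem MatPoly.conj_smul (c : ℂ) (P : MatPoly m ι) :
    MatPoly.conj (c • P) = star c • P.conj := by
  ext1 j
  simp [MatPoly.conj, Matrix.conjTranspose_smul]

theorem MatPoly.conj_neg (P : MatPoly m ι) : MatPoly.conj (-P) = -P.conj := by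
  ext1 j
  simp [MatPoly.conj]

theorem MatPoly.continuous_value (z : ℂ) :
    Continuous fun P : MatPoly m ι => P.value z := by
  unfold MatPoly.value
  fun_prop

theorem MatPoly.continuous_conj : Continuous (MatPoly.conj : MatPoly m ι → MatPoly m ι) := by
  unfold MatPoly.conj
  fun_prop

theorem isClosed_hPalindromic : IsClosed (hPalindromic m ι) := by
  simp only [hPalindromic, Set.ofPred_forall]
  exact isClosed_iInter fun z => isClosed_iInter fun _ => isClosed_eq
    ((MatPoly.continuous_value z).comp MatPoly.continuous_conj)
    ((MatPoly.continuous_value (1 / z)).const_smul (z ^ m))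

theorem isClosed_hAntiPalindromic : IsClosed (hAntiPalindromic m ι) := by
  simp only [hAntiPalindromic, Set.ofPred_forall]
  exact isClosed_iInter fun z => isClosed_iInter fun _ => isClosed_eq
    ((MatPoly.continuous_value z).comp MatPoly.continuous_conj)
    ((MatPoly.continuous_value (1 / z)).const_smul (z ^ m)).neg

theorem neg_mem_hPalindromic {P : MatPoly m ι} (hP : P ∈ hPalindromic m ι) :
    -P ∈ hPalindromic m ι := fun z hz => by
  rw [MatPoly.conj_neg, MatPoly.value_neg, MatPoly.value_neg, hP z hz, smul_neg]

theorem neg_mem_hAntiPalindromic {P : MatPoly m ι} (hP : P ∈ hAntiPalindromic m ι) :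
    -P ∈ hAntiPalindromic m ι := fun z hz => by
  rw [MatPoly.conj_neg, MatPoly.value_neg, MatPoly.value_neg, hP z hz, smul_neg]

/-- Conjugation sends `i` to `-i`, so multiplying by `i` flips the sign in the symmetry. -/
theorem I_smul_mem_hPalindromic {P : MatPoly m ι} (hP : P ∈ hAntiPalindromic m ι) :
    Complex.I • P ∈ hPalindromic m ι := fun z hz => by
  rw [MatPoly.conj_smul, MatPoly.value_smul, MatPoly.value_smul, hP z hz, smul_comm]
  simp

theorem I_smul_mem_hAntiPalindromic {P : MatPoly m ι} (hP : P ∈ hPalindromic m ι) :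
    Complex.I • P ∈ hAntiPalindromic m ι := fun z hz => by
  rw [MatPoly.conj_smul, MatPoly.value_smul, MatPoly.value_smul, hP z hz, smul_comm]
  simp

theorem mem_hPalindromic_of_rev {P : MatPoly m ι} (h : ∀ j, P (Fin.rev j) = (P j)ᴴ) :
    P ∈ hPalindromic m ι := by
  intro z hz
  rw [MatPoly.value, MatPoly.value,
    ← Equiv.sum_comp Fin.revPerm fun j : Fin (m + 1) => (1 / z) ^ (j : ℕ) • P j, Finset.smul_sum]
  refine Finset.sum_congr rfl fun j _ => ?_
  have hj : (j : ℕ) + (m - j) = m := by omega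
  rw [Fin.revPerm_apply, h, Fin.val_rev, MatPoly.conj, smul_smul,
    show m + 1 - ((j : ℕ) + 1) = m - j by omega]
  congr 1
  nth_rewrite 2 [← hj]
  rw [pow_add, one_div, inv_pow]
  field_simp

theorem star_eq_inv_of_norm_eq_one {z : ℂ} (hz : ‖z‖ = 1) : star z = z⁻¹ := by
  rw [Complex.inv_def, Complex.normSq_eq_norm_sq, hz]
  simp

/-- For `|z| = 1` the symmetry reads `P(z)ᴴ = z⁻ᵐ P(z)`; a square root of `z` splits the factor
evenly between the two sides. -/
theorem isHermitian_smul_value {P : MatPoly m ι} (hP : P ∈ hPalindromic m ι) {s : ℂ}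
    (hs : ‖s‖ = 1) : (s⁻¹ ^ m • P.value (s ^ 2)).IsHermitian := by
  have hs0 : s ≠ 0 := norm_ne_zero_iff.1 (by rw [hs]; exact one_ne_zero)
  have h := hP (star (s ^ 2)) (star_ne_zero.2 (pow_ne_zero 2 hs0))
  rw [MatPoly.conj_value, star_star, star_pow, star_eq_inv_of_norm_eq_one hs, one_div, inv_pow,
    inv_inv] at h
  rw [Matrix.IsHermitian, Matrix.conjTranspose_smul, h, star_pow, star_inv₀,
    star_eq_inv_of_norm_eq_one hs, inv_inv, smul_smul]
  congr 1
  rw [← mul_pow]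
  congr 1
  field_simp

theorem norm_inv_pow_smul_mulVec [Fintype ι] {s : ℂ} (hs : ‖s‖ = 1) (A : Matrix ι ι ℂ)
    (u : ι → ℂ) :
    ‖WithLp.toLp 2 ((s⁻¹ ^ m • A) *ᵥ u)‖ = ‖WithLp.toLp 2 (A *ᵥ u)‖ := by
  rw [Matrix.smul_mulVec, norm_toLp_smul, norm_pow, norm_inv, hs]
  simp

/-! ### Attainment of the minima and bounds on the unit circle. -/

variable [Fintype ι] [DecidableEq ι]

theorem MatPoly.norm_nonneg (M : NormKind) (P : MatPoly m ι) : 0 ≤ P.norm M :=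
  Real.sqrt_nonneg _

theorem MatPoly.continuous_norm (M : NormKind) :
    Continuous (MatPoly.norm M : MatPoly m ι → ℝ) := by
  unfold MatPoly.norm
  exact Real.continuous_sqrt.comp (continuous_finsetSum _ fun j _ =>
    ((continuous_matNorm M).comp (continuous_apply j)).pow 2)

theorem MatPoly.matNorm_coeff_le_norm (M : NormKind) (P : MatPoly m ι) (j : Fin (m + 1)) :
    matNorm M (P j) ≤ P.norm M := by
  refine Real.le_sqrt_of_sq_le ?_
  exact Finset.single_le_sum (f := fun j => matNorm M (P j) ^ 2) (fun _ _ => sq_nonneg _)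
    (Finset.mem_univ j)

theorem MatPoly.norm_smul (M : NormKind) (c : ℂ) (P : MatPoly m ι) :
    MatPoly.norm M (c • P) = ‖c‖ * P.norm M := by
  simp only [MatPoly.norm, Pi.smul_apply, matNorm_smul, mul_pow, ← Finset.mul_sum]
  rw [Real.sqrt_mul (sq_nonneg _), Real.sqrt_sq (_root_.norm_nonneg c)]

/-- Unimodular multiples of one matrix, scaled by `1 / (m + 1)`. -/
theorem MatPoly.norm_unimodular_smul (M : NormKind) {c : Fin (m + 1) → ℂ} (hc : ∀ j, ‖c j‖ = 1)
    (A : Matrix ι ι ℂ) :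
    MatPoly.norm M (fun j => (((m : ℂ) + 1)⁻¹ * c j) • A) =
      matNorm M A / Real.sqrt ((m : ℝ) + 1) := by
  have h1 : ‖((m : ℂ) + 1)⁻¹‖ = ((m : ℝ) + 1)⁻¹ := by
    rw [norm_inv]
    norm_cast
  have h2 : (0 : ℝ) < (m : ℝ) + 1 := by positivity
  simp only [MatPoly.norm, matNorm_smul, norm_mul, hc, h1, mul_one]
  rw [Finset.sum_const, Finset.card_univ, Fintype.card_fin, nsmul_eq_mul,
    Real.sqrt_eq_iff_eq_sq (by positivity) (div_nonneg (matNorm_nonneg M A) (Real.sqrt_nonneg _)),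
    div_pow, Real.sq_sqrt h2.le]
  push_cast
  field_simp

theorem MatPoly.norm_value_mulVec_le (M : NormKind) (P : MatPoly m ι) {z : ℂ} (hz : ‖z‖ = 1)
    (u : ι → ℂ) :
    ‖WithLp.toLp 2 (P.value z *ᵥ u)‖ ≤
      Real.sqrt ((m : ℝ) + 1) * P.norm M * ‖WithLp.toLp 2 u‖ := by
  have h1 : ‖WithLp.toLp 2 (P.value z *ᵥ u)‖ ≤ ∑ j, matNorm M (P j) * ‖WithLp.toLp 2 u‖ := by
    rw [MatPoly.value, Matrix.sum_mulVec, WithLp.toLp_sum]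
    refine norm_sum_le_of_le _ fun j _ => ?_
    rw [Matrix.smul_mulVec, norm_toLp_smul, norm_pow, hz, one_pow, one_mul]
    exact norm_mulVec_le_matNorm M _ _
  rw [← Finset.sum_mul] at h1
  refine h1.trans (mul_le_mul_of_nonneg_right ?_ (_root_.norm_nonneg _))
  rw [MatPoly.norm, ← Real.sqrt_mul (by positivity)]
  refine Real.le_sqrt_of_sq_le ?_
  simpa using sq_sum_le_card_mul_sum_sq (s := Finset.univ) (f := fun j => matNorm M (P j))

theorem bddBelow_perturbationNorms (M : NormKind) (S : Set (MatPoly m ι)) (z : ℂ) (u : ι → ℂ)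
    (P : MatPoly m ι) : BddBelow (perturbationNorms M S z u P) :=
  ⟨0, by rintro e ⟨D, -, -, rfl⟩; exact D.norm_nonneg M⟩

theorem structuredBackwardError_le_norm {M : NormKind} {S : Set (MatPoly m ι)} {z : ℂ} {u : ι → ℂ}
    {P D : MatPoly m ι} (hD : D ∈ S) (h : P.value z *ᵥ u + D.value z *ᵥ u = 0) :
    structuredBackwardError M S z u P ≤ D.norm M :=
  csInf_le (bddBelow_perturbationNorms M S z u P) ⟨D, hD, h, rfl⟩

/-- Since `-P` is feasible, only perturbations no larger than `-P` matter; these form a closed set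
with bounded entries, hence a compact one. -/
theorem isLeast_structuredBackwardError (M : NormKind) {S : Set (MatPoly m ι)} (hS : IsClosed S)
    (z : ℂ) (u : ι → ℂ) {P : MatPoly m ι} (hP : -P ∈ S) :
    IsLeast (perturbationNorms M S z u P) (structuredBackwardError M S z u P) := by
  obtain ⟨K, hK⟩ : ∃ K : Set (MatPoly m ι), K =
    {D | D ∈ S ∧ P.value z *ᵥ u + D.value z *ᵥ u = 0 ∧ D.norm M ≤ (-P).norm M} := ⟨_, rfl⟩
  have hfeas : P.value z *ᵥ u + (-P).value z *ᵥ u = 0 := by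
    rw [MatPoly.value_neg, Matrix.neg_mulVec, add_neg_cancel]
  have hclosed : IsClosed K := by
    rw [hK]
    refine hS.inter (IsClosed.inter (isClosed_eq ?_ continuous_const)
      (isClosed_le (MatPoly.continuous_norm M) continuous_const))
    exact continuous_const.add ((MatPoly.continuous_value z).matrix_mulVec continuous_const)
  have hcompact : IsCompact K := by
    refine IsCompact.of_isClosed_subset (isCompact_univ_pi fun _ : Fin (m + 1) =>
      isCompact_univ_pi fun _ : ι => isCompact_univ_pi fun _ : ι =>
        isCompact_closedBall (0 : ℂ) ((-P).norm M)) hclosed ?_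
    rw [hK]
    rintro D ⟨-, -, hD⟩ j - a - b -
    rw [mem_closedBall_zero_iff]
    exact (norm_entry_le_matNorm M (D j) a b).trans ((D.matNorm_coeff_le_norm M j).trans hD)
  obtain ⟨D, hDK, hmin⟩ := hcompact.exists_isMinOn ⟨-P, by rw [hK]; exact ⟨hP, hfeas, le_rfl⟩⟩
    (MatPoly.continuous_norm M).continuousOn
  rw [hK] at hDK
  have hleast : IsLeast (perturbationNorms M S z u P) (D.norm M) := by
    refine ⟨⟨D, hDK.1, hDK.2.1, rfl⟩, ?_⟩
    rintro e ⟨E, hE, hEu, rfl⟩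
    by_cases h : E.norm M ≤ (-P).norm M
    · exact hmin (by rw [hK]; exact ⟨hE, hEu, h⟩)
    · exact hDK.2.2.trans (not_le.1 h).le
  rwa [structuredBackwardError, hleast.csInf_eq]

theorem norm_residual_le (M : NormKind) {S : Set (MatPoly m ι)} {z : ℂ} (hz : ‖z‖ = 1)
    {u : ι → ℂ} {P : MatPoly m ι}
    (h : IsLeast (perturbationNorms M S z u P) (structuredBackwardError M S z u P)) :
    ‖WithLp.toLp 2 (P.value z *ᵥ u)‖ ≤
      Real.sqrt ((m : ℝ) + 1) * structuredBackwardError M S z u P * ‖WithLp.toLp 2 u‖ := by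
  obtain ⟨D, -, hD, hn⟩ := h.1
  rw [eq_neg_of_add_eq_zero_left hD, ← hn, WithLp.toLp_neg, norm_neg]
  exact D.norm_value_mulVec_le M hz u

/-- The weights `z⁻ʲ / (m+1)` align all terms at `z` and share them equally, the equality case of
Cauchy–Schwarz. -/
theorem backwardError_le (M : NormKind) {z : ℂ} (hz : ‖z‖ = 1) {u : ι → ℂ}
    (hu : ‖WithLp.toLp 2 u‖ = 1) (P : MatPoly m ι) :
    backwardError M z u P ≤ ‖WithLp.toLp 2 (P.value z *ᵥ u)‖ / Real.sqrt ((m : ℝ) + 1) := by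
  have hz0 : z ≠ 0 := norm_ne_zero_iff.1 (by rw [hz]; exact one_ne_zero)
  obtain ⟨A, hA⟩ : ∃ A, A = Matrix.vecMulVec (-(P.value z *ᵥ u)) (star u) := ⟨_, rfl⟩
  have hAu : A *ᵥ u = -(P.value z *ᵥ u) := by
    rw [hA, Matrix.vecMulVec_mulVec, star_dotProduct_self_eq_norm_sq, hu]
    simp
  have hAn : matNorm M A ≤ ‖WithLp.toLp 2 (P.value z *ᵥ u)‖ := by
    refine (matNorm_le_frobNorm M A).trans ?_
    rw [hA, frobNorm_vecMulVec, hu, mul_one, WithLp.toLp_neg, norm_neg]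
  have hD := MatPoly.norm_unimodular_smul (m := m) M (c := fun j => z⁻¹ ^ (j : ℕ))
    (fun j => by rw [norm_pow, norm_inv, hz]; simp) A
  refine (structuredBackwardError_le_norm (Set.mem_univ
    (fun j : Fin (m + 1) => (((m : ℂ) + 1)⁻¹ * z⁻¹ ^ (j : ℕ)) • A)) ?_).trans ?_
  · have hval : MatPoly.value (fun j : Fin (m + 1) => (((m : ℂ) + 1)⁻¹ * z⁻¹ ^ (j : ℕ)) • A) z =
        A := by
      have : ∀ j : Fin (m + 1), z ^ (j : ℕ) • (((m : ℂ) + 1)⁻¹ * z⁻¹ ^ (j : ℕ)) • A =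
          ((m : ℂ) + 1)⁻¹ • A := fun j => by
        rw [smul_smul, inv_pow]
        congr 1
        field_simp
      rw [MatPoly.value, Finset.sum_congr rfl fun j _ => this j, Finset.sum_const,
        Finset.card_univ, Fintype.card_fin, ← Nat.cast_smul_eq_nsmul ℂ, smul_smul]
      push_cast
      rw [mul_inv_cancel₀ (Nat.cast_add_one_ne_zero m), one_smul]
    rw [hval, hAu, add_neg_cancel]
  · rw [hD]
    gcongr

/-- A Hermitian matrix that agrees on `u` with the Hermitian matrix `s⁻ᵐ P(s²)` yields a
palindromic perturbation annihilating the residual. -/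
theorem structuredBackwardError_hPalindromic_le (M : NormKind) {s : ℂ} (hs : ‖s‖ = 1)
    {u : ι → ℂ} {P : MatPoly m ι} {K : Matrix ι ι ℂ} (hK : K.IsHermitian)
    (hKu : K *ᵥ u = (s⁻¹ ^ m • P.value (s ^ 2)) *ᵥ u) :
    structuredBackwardError M (hPalindromic m ι) (s ^ 2) u P ≤
      matNorm M K / Real.sqrt ((m : ℝ) + 1) := by
  have hs0 : s ≠ 0 := norm_ne_zero_iff.1 (by rw [hs]; exact one_ne_zero)
  have hm : (m : ℂ) + 1 ≠ 0 := Nat.cast_add_one_ne_zero m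
  -- Here `c j = -s^(m-2j)`: the products `s^(2j) c j` all equal `-s^m`, and `c (m-j)` is the
  -- conjugate of `c j`.
  obtain ⟨c, hc⟩ : ∃ c : Fin (m + 1) → ℂ,
    c = fun j : Fin (m + 1) => -((s⁻¹ ^ 2) ^ (j : ℕ) * s ^ m) := ⟨_, rfl⟩
  have hcn : ∀ j, ‖c j‖ = 1 := fun j => by simp [hc, hs]
  obtain ⟨D, hD⟩ : ∃ D : MatPoly m ι, D = fun j => (((m : ℂ) + 1)⁻¹ * c j) • K := ⟨_, rfl⟩
  have hDp : D ∈ hPalindromic m ι := by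
    refine mem_hPalindromic_of_rev fun j => ?_
    simp only [hD, Matrix.conjTranspose_smul, hK.eq]
    congr 1
    obtain ⟨k, hk⟩ : ∃ k, k = m - (j : ℕ) := ⟨_, rfl⟩
    have hmk : m = j + k := by omega
    simp only [hc, Fin.val_rev]
    rw [show m + 1 - ((j : ℕ) + 1) = k by omega]
    have hmstar : star (((m : ℂ) + 1)⁻¹) = ((m : ℂ) + 1)⁻¹ := by simp
    rw [star_mul', hmstar, star_neg, star_mul', star_pow, star_pow, star_pow, star_inv₀,
      star_eq_inv_of_norm_eq_one hs, inv_inv]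
    have : (s⁻¹ ^ 2) ^ k * s ^ m = (s ^ 2) ^ (j : ℕ) * s⁻¹ ^ m := by
      generalize (j : ℕ) = i at hmk
      simp only [hmk, inv_pow, pow_add]
      field_simp
      ring
    rw [this]
  have hval : D.value (s ^ 2) = -(s ^ m • K) := by
    have : ∀ j : Fin (m + 1), (s ^ 2) ^ (j : ℕ) • (((m : ℂ) + 1)⁻¹ * c j) • K =
        ((m : ℂ) + 1)⁻¹ • (-(s ^ m • K)) := fun j => by
      rw [smul_smul, hc, ← neg_smul, smul_smul]
      congr 1
      simp only [inv_pow]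
      field_simp
    rw [hD, MatPoly.value, Finset.sum_congr rfl fun j _ => this j, Finset.sum_const,
      Finset.card_univ, Fintype.card_fin, ← Nat.cast_smul_eq_nsmul ℂ, smul_smul]
    push_cast
    rw [mul_inv_cancel₀ hm, one_smul]
  refine (structuredBackwardError_le_norm hDp ?_).trans_eq
    (hD ▸ MatPoly.norm_unimodular_smul M hcn K)
  rw [hval, Matrix.neg_mulVec, Matrix.smul_mulVec, hKu, Matrix.smul_mulVec, smul_smul, ← mul_pow,
    mul_inv_cancel₀ hs0, one_pow, one_smul, add_neg_cancel]

theorem exists_unit_sq_eq {z : ℂ} (hz : ‖z‖ = 1) : ∃ s : ℂ, ‖s‖ = 1 ∧ s ^ 2 = z := by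
  obtain ⟨s, hs⟩ := IsAlgClosed.exists_pow_nat_eq z (n := 2) (by norm_num)
  refine ⟨s, ?_, hs⟩
  rw [← hs, norm_pow] at hz
  exact (pow_eq_one_iff_of_nonneg (norm_nonneg s) two_ne_zero).1 hz

theorem hPalindromic_backwardError_le (M : NormKind) {z : ℂ} (hz : ‖z‖ = 1) {u : ι → ℂ}
    (hu : ‖WithLp.toLp 2 u‖ ≠ 0) {P : MatPoly m ι} (hP : P ∈ hPalindromic m ι) :
    structuredBackwardError M (hPalindromic m ι) z u P ≤
      Real.sqrt 2 * (‖WithLp.toLp 2 (P.value z *ᵥ u)‖ / ‖WithLp.toLp 2 u‖) /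
        Real.sqrt ((m : ℝ) + 1) := by
  obtain ⟨s, hs, rfl⟩ := exists_unit_sq_eq hz
  obtain ⟨K, hK, hKu, hn⟩ := exists_isHermitian_frobNorm_le (isHermitian_smul_value hP hs) hu
  rw [norm_inv_pow_smul_mulVec hs] at hn
  refine (structuredBackwardError_hPalindromic_le M hs hK hKu).trans ?_
  gcongr
  exact (matNorm_le_frobNorm M K).trans hn

theorem hPalindromic_spectral_backwardError_le {z : ℂ} (hz : ‖z‖ = 1) {u : ι → ℂ}
    (hu : ‖WithLp.toLp 2 u‖ = 1) {P : MatPoly m ι} (hP : P ∈ hPalindromic m ι) :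
    structuredBackwardError NormKind.two (hPalindromic m ι) z u P ≤
      ‖WithLp.toLp 2 (P.value z *ᵥ u)‖ / Real.sqrt ((m : ℝ) + 1) := by
  obtain ⟨s, hs, rfl⟩ := exists_unit_sq_eq hz
  obtain ⟨K, hK, hKu, hn⟩ := exists_isHermitian_specNorm_le (isHermitian_smul_value hP hs) hu
  rw [norm_inv_pow_smul_mulVec hs] at hn
  refine (structuredBackwardError_hPalindromic_le NormKind.two hs hK hKu).trans ?_
  gcongr
  exact hn

theorem hAntiPalindromic_backwardError_le (M : NormKind) {z : ℂ} (hz : ‖z‖ = 1) {u : ι → ℂ}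
    (hu : ‖WithLp.toLp 2 u‖ ≠ 0) {P : MatPoly m ι} (hP : P ∈ hAntiPalindromic m ι) :
    structuredBackwardError M (hAntiPalindromic m ι) z u P ≤
      Real.sqrt 2 * (‖WithLp.toLp 2 (P.value z *ᵥ u)‖ / ‖WithLp.toLp 2 u‖) /
        Real.sqrt ((m : ℝ) + 1) := by
  have hIP := I_smul_mem_hPalindromic hP
  obtain ⟨D, hD, hDu, hn⟩ := (isLeast_structuredBackwardError M isClosed_hPalindromic z u
    (neg_mem_hPalindromic hIP)).1
  have hle := hPalindromic_backwardError_le M hz hu hIP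
  rw [← hn, MatPoly.value_smul, Matrix.smul_mulVec, norm_toLp_smul, Complex.norm_I, one_mul] at hle
  refine le_trans ?_ hle
  -- Since `D` cancels the residual of `i P`, the perturbation `-i D` cancels that of `P`, at the
  -- same norm.
  have hnorm : (-(Complex.I • D)).norm M = D.norm M := by
    rw [← neg_smul, MatPoly.norm_smul, norm_neg, Complex.norm_I, one_mul]
  rw [← hnorm]
  refine structuredBackwardError_le_norm
    (neg_mem_hAntiPalindromic (I_smul_mem_hAntiPalindromic hD)) ?_
  rw [MatPoly.value_neg, MatPoly.value_smul, Matrix.neg_mulVec, Matrix.smul_mulVec,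
    eq_neg_of_add_eq_zero_right hDu, MatPoly.value_smul, Matrix.smul_mulVec, smul_neg, smul_smul,
    Complex.I_mul_I]
  simp

end MatPoly

/-! ### Kronecker vectors and the ansatz identity. -/

section Ansatz

variable {m n : ℕ}

theorem norm_kronVec (w : Fin m → ℂ) (x : Fin n → ℂ) :
    ‖WithLp.toLp 2 (kronVec w x)‖ = ‖WithLp.toLp 2 w‖ * ‖WithLp.toLp 2 x‖ := by
  rw [← sq_eq_sq₀ (norm_nonneg _) (by positivity), mul_pow, EuclideanSpace.norm_sq_eq,
    EuclideanSpace.norm_sq_eq, EuclideanSpace.norm_sq_eq, Finset.sum_mul_sum,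
    Fintype.sum_prod_type]
  simp [kronVec, mul_pow]

theorem norm_lambdaVec {z : ℂ} (hz : ‖z‖ = 1) :
    ‖WithLp.toLp 2 (lambdaVec m z)‖ = Real.sqrt m := by
  rw [EuclideanSpace.norm_eq]
  simp [lambdaVec, hz]

theorem kronMat_mulVec (w : Fin m → ℂ) (B : Matrix (Fin n) (Fin n) ℂ) (x : Fin n → ℂ) :
    kronMat w B *ᵥ x = kronVec w (B *ᵥ x) := by
  ext p
  simp [kronMat, kronVec, Matrix.mulVec, dotProduct, Finset.mul_sum, mul_assoc]

theorem ansatzPencils_value_mulVec {P : MatPoly m (Fin n)} {v : Fin m → ℂ}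
    {L : MatPoly 1 (Fin m × Fin n)} (hL : L ∈ ansatzPencils P v) (z : ℂ) (x : Fin n → ℂ) :
    L.value z *ᵥ kronVec (lambdaVec m z) x = kronVec v (P.value z *ᵥ x) := by
  rw [← kronMat_mulVec, ← hL z, ← Matrix.mulVec_mulVec, kronMat_mulVec, Matrix.one_mulVec]

end Ansatz

/-! ### Comparison of the pencil with the polynomial. -/

theorem theorem4p5 {m n : ℕ}
    (P : MatPoly m (Fin n)) (hP : P ∈ hPalindromic m (Fin n))
    (v : Fin m → ℂ) (hv : ‖WithLp.toLp 2 v‖ = 1)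
    (L : MatPoly 1 (Fin m × Fin n)) (hL : L ∈ ansatzPencils P v)
    (S : Set (MatPoly 1 (Fin m × Fin n))) (hLS : L ∈ S)
    (hS : (S = hPalindromic 1 (Fin m × Fin n) ∧ ∀ i, v (Fin.rev i) = star (v i)) ∨
      (S = hAntiPalindromic 1 (Fin m × Fin n) ∧ ∀ i, v (Fin.rev i) = -star (v i)))
    (μ : ℂ) (hμ : ‖μ‖ = 1) (x : Fin n → ℂ) (hx : ‖WithLp.toLp 2 x‖ = 1) :
    -- all minima that define the backward errors are attained
    (∀ M : NormKind,
      IsLeast (perturbationNorms M Set.univ μ x P) (backwardError M μ x P) ∧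
      IsLeast (perturbationNorms M (hPalindromic m (Fin n)) μ x P)
        (structuredBackwardError M (hPalindromic m (Fin n)) μ x P) ∧
      IsLeast (perturbationNorms M S μ (kronVec (lambdaVec m μ) x) L)
        (structuredBackwardError M S μ (kronVec (lambdaVec m μ) x) L)) ∧
    -- Frobenius norm
    (Real.sqrt (((m : ℝ) + 1) / (2 * (m : ℝ))) * backwardError NormKind.F μ x P ≤
        structuredBackwardError NormKind.F S μ (kronVec (lambdaVec m μ) x) L ∧
      structuredBackwardError NormKind.F S μ (kronVec (lambdaVec m μ) x) L ≤
        Real.sqrt 2 * backwardError NormKind.F μ x P ∧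
      structuredBackwardError NormKind.F S μ (kronVec (lambdaVec m μ) x) L ≤
        Real.sqrt 2 * structuredBackwardError NormKind.F (hPalindromic m (Fin n)) μ x P) ∧
    -- spectral norm
    (Real.sqrt (((m : ℝ) + 1) / (2 * (m : ℝ))) * backwardError NormKind.two μ x P ≤
        structuredBackwardError NormKind.two S μ (kronVec (lambdaVec m μ) x) L ∧
      backwardError NormKind.two μ x P =
        structuredBackwardError NormKind.two (hPalindromic m (Fin n)) μ x P ∧
      structuredBackwardError NormKind.two S μ (kronVec (lambdaVec m μ) x) L ≤
        Real.sqrt 2 * backwardError NormKind.two μ x P) := by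
  -- A unit ansatz vector cannot live in the zero space `ℂ⁰`.
  have hm : 1 ≤ m := by
    rcases Nat.eq_zero_or_pos m with rfl | h
    · rw [Subsingleton.elim (WithLp.toLp 2 v) 0, norm_zero] at hv
      exact absurd hv zero_ne_one
    · exact h
  have hm' : (1 : ℝ) ≤ m := by exact_mod_cast hm
  obtain ⟨r, hr⟩ : ∃ r, r = ‖WithLp.toLp 2 (P.value μ *ᵥ x)‖ := ⟨_, rfl⟩
  have hr0 : 0 ≤ r := hr ▸ norm_nonneg _
  have hu : ‖WithLp.toLp 2 (kronVec (lambdaVec m μ) x)‖ = Real.sqrt m := by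
    rw [norm_kronVec, norm_lambdaVec hμ, hx, mul_one]
  have hu0 : ‖WithLp.toLp 2 (kronVec (lambdaVec m μ) x)‖ ≠ 0 := by
    rw [hu]; positivity
  have hLu : ‖WithLp.toLp 2 (L.value μ *ᵥ kronVec (lambdaVec m μ) x)‖ = r := by
    rw [ansatzPencils_value_mulVec hL, norm_kronVec, hv, one_mul, hr]
  have hleastP (M : NormKind) : IsLeast (perturbationNorms M Set.univ μ x P)
      (backwardError M μ x P) :=
    isLeast_structuredBackwardError M isClosed_univ μ x (Set.mem_univ _)
  have hleastPal (M : NormKind) : IsLeast (perturbationNorms M (hPalindromic m (Fin n)) μ x P)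
      (structuredBackwardError M (hPalindromic m (Fin n)) μ x P) :=
    isLeast_structuredBackwardError M isClosed_hPalindromic μ x (neg_mem_hPalindromic hP)
  have hleastL (M : NormKind) : IsLeast (perturbationNorms M S μ (kronVec (lambdaVec m μ) x) L)
      (structuredBackwardError M S μ (kronVec (lambdaVec m μ) x) L) := by
    rcases hS with ⟨rfl, -⟩ | ⟨rfl, -⟩
    · exact isLeast_structuredBackwardError M isClosed_hPalindromic μ _ (neg_mem_hPalindromic hLS)
    · exact isLeast_structuredBackwardError M isClosed_hAntiPalindromic μ _
        (neg_mem_hAntiPalindromic hLS)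
  have hupL (M : NormKind) : structuredBackwardError M S μ (kronVec (lambdaVec m μ) x) L ≤
      r / Real.sqrt m := by
    -- A pencil has two coefficients, so the divisor `√(1+1)` cancels the `√2` of the Hermitian
    -- extension.
    have key : structuredBackwardError M S μ (kronVec (lambdaVec m μ) x) L ≤
        Real.sqrt 2 * (r / Real.sqrt m) / Real.sqrt (((1 : ℕ) : ℝ) + 1) := by
      rw [← hLu, ← hu]
      rcases hS with ⟨rfl, -⟩ | ⟨rfl, -⟩
      · exact hPalindromic_backwardError_le M hμ hu0 hLS
      · exact hAntiPalindromic_backwardError_le M hμ hu0 hLS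
    refine key.trans_eq ?_
    rw [Nat.cast_one, one_add_one_eq_two]
    field_simp
  have hloL (M : NormKind) : r ≤ Real.sqrt 2 *
      structuredBackwardError M S μ (kronVec (lambdaVec m μ) x) L * Real.sqrt m := by
    have h := norm_residual_le M hμ (hleastL M)
    rwa [hLu, hu, Nat.cast_one, one_add_one_eq_two] at h
  have hupP (M : NormKind) : backwardError M μ x P ≤ r / Real.sqrt ((m : ℝ) + 1) :=
    hr ▸ backwardError_le M hμ hx P
  have hloP (M : NormKind) : r / Real.sqrt ((m : ℝ) + 1) ≤ backwardError M μ x P := by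
    have h := norm_residual_le M hμ (hleastP M)
    rw [← hr, hx, mul_one] at h
    rw [div_le_iff₀' (by positivity)]
    exact h
  have hPPal (M : NormKind) : backwardError M μ x P ≤
      structuredBackwardError M (hPalindromic m (Fin n)) μ x P := by
    obtain ⟨D, -, hD, hn⟩ := (hleastPal M).1
    exact (hleastP M).2 ⟨D, Set.mem_univ _, hD, hn⟩
  have hlower (M : NormKind) : Real.sqrt (((m : ℝ) + 1) / (2 * (m : ℝ))) * backwardError M μ x P ≤
      structuredBackwardError M S μ (kronVec (lambdaVec m μ) x) L := by
    calc Real.sqrt (((m : ℝ) + 1) / (2 * (m : ℝ))) * backwardError M μ x P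
        ≤ Real.sqrt (((m : ℝ) + 1) / (2 * (m : ℝ))) * (r / Real.sqrt ((m : ℝ) + 1)) := by
          gcongr; exact hupP M
      _ = r / (Real.sqrt 2 * Real.sqrt m) := by
          rw [Real.sqrt_div (by positivity), Real.sqrt_mul (by norm_num)]
          field_simp
      _ ≤ _ := by
          rw [div_le_iff₀ (by positivity)]
          linarith [hloL M]
  have hupper (M : NormKind) : structuredBackwardError M S μ (kronVec (lambdaVec m μ) x) L ≤
      Real.sqrt 2 * backwardError M μ x P := by
    calc _ ≤ r / Real.sqrt m := hupL M
      _ ≤ Real.sqrt 2 * (r / Real.sqrt ((m : ℝ) + 1)) := by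
          -- This is `m + 1 ≤ 2m`.
          have h : Real.sqrt ((m : ℝ) + 1) ≤ Real.sqrt 2 * Real.sqrt m := by
            rw [← Real.sqrt_mul (by norm_num)]
            exact Real.sqrt_le_sqrt (by linarith)
          rw [← mul_div_assoc, div_le_div_iff₀ (by positivity) (by positivity)]
          nlinarith [mul_le_mul_of_nonneg_left h hr0]
      _ ≤ _ := by gcongr; exact hloP M
  refine ⟨fun M => ⟨hleastP M, hleastPal M, hleastL M⟩,
    ⟨hlower _, hupper _, (hupper _).trans ?_⟩, hlower _, le_antisymm (hPPal _) ?_, hupper _⟩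
  · gcongr
    exact hPPal _
  · exact (hr ▸ hPalindromic_spectral_backwardError_le hμ hx hP).trans (hloP _)
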